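/- Let $r\ge 0$, $n\ge 1$, $k$ and $\lambda$ be integers ($k,\lambda\ge 1$) with $r\le n\le k$, and let $\rho=(\rho_1,\dots,\rho_k)$ be a $k$-tuple of integers with $1\le\rho_\ell\le\lambda n$ for every $\ell\in[k]=\{1,\dots,k\}$ and $\sum_{\ell\in[k]}\rho_\ell=\lambda n^2$. An $r\times s$ $(\rho,\lambda)$-Latin rectangle is an $r\times s$ array $M$ in which each cell contains a multiset of exactly $\lambda$ elements (counted with multiplicity) of the symbol set $[k]$, such that each symbol $\ell$ occurs at most $\rho_\ell$ times in $M$, at most $\lambda$ times in each row and at most $\lambda$ times in each column. An $n\times n$ $(\rho,\lambda)$-Latin square is defined in the same way with $r=s=n$, except that each symbol $\ell$ occurs exactly $\rho_\ell$ times in the array. Such a rectangle or square is simple if no cell contains a symbol more than once. Write $|M_\ell|$ and $|{}^jM_\ell|$ for the number of occurrences of $\ell$ in $M$ and in column $j$ of $M$, respectively, and put $x\mathbin{\dot-}y=\max\{0,x-y\}$ and $\bar K=[k]\setminus K$. Let $M$ be a simple $r\times n$ $(\rho,\lambda)$-Latin rectangle. Then $M$ can be extended to a simple $n\times n$ $(\rho,\lambda)$-Latin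 square (that is, there is such a square whose first $r$ rows form $M$) if and only if $\lambda\le k$ and $$\rho_\ell-|M_\ell|\le\lambda(n-r)\qquad\text{for all }\ell\in[k],$$ $$\lambda(n-r)\le\sum_{\ell\in[k]}\min\{n-r,\ \lambda-|{}^jM_\ell|\}\qquad\text{for all }j\in[n],$$ $$\rho_\ell-|M_\ell|\le\sum_{j\in[n]}\min\{n-r,\ \lambda-|{}^jM_\ell|\}\qquad\text{for all }\ell\in[k],$$ $$\sum_{j\in[n]}\Bigl(\lambda(n-r)\mathbin{\dot-}\sum_{\ell\in K}\min\{n-r,\ \lambda-|{}^jM_\ell|\}\Bigr)\le\sum_{\ell\in\bar K}\bigl(\rho_\ell-|M_\ell|\bigr)\qquad\text{for all }K\subseteq[k].$$ -/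

import Mathlib

/-- An `r × s` array whose cells contain multisets of symbols from a set of `k` symbols. -/
abbrev SymbolArray (r s k : ℕ) : Type := Fin r → Fin s → Multiset (Fin k)

namespace SymbolArray

variable {r s k : ℕ}

/-- The number `|^j M^i_ℓ|` of occurrences of the symbol `ℓ` in cell `(i, j)`. -/
def cellOcc (M : SymbolArray r s k) (i : Fin r) (j : Fin s) (l : Fin k) : ℕ :=
  (M i j).count l

/-- The number `|M^i_ℓ|` of occurrences of the symbol `ℓ` in row `i`. -/
def rowOcc (M : SymbolArray r s k) (i : Fin r) (l : Fin k) : ℕ :=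
  ∑ j, M.cellOcc i j l

/-- The number `|^j M_ℓ|` of occurrences of the symbol `ℓ` in column `j`. -/
def colOcc (M : SymbolArray r s k) (j : Fin s) (l : Fin k) : ℕ :=
  ∑ i, M.cellOcc i j l

/-- The number `|M_ℓ|` of occurrences of the symbol `ℓ` in the whole array. -/
def occ (M : SymbolArray r s k) (l : Fin k) : ℕ :=
  ∑ i, ∑ j, M.cellOcc i j l

/-- A `lam`-matrix: every cell contains exactly `lam` symbols, counted with multiplicity. -/
def IsLambdaMatrix (lam : ℕ) (M : SymbolArray r s k) : Prop :=
  ∀ i j, Multiset.card (M i j) = lam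

/-- An `r × s` `(ρ, lam)`-Latin rectangle. -/
structure IsLatinRectangle (ρ : Fin k → ℕ) (lam : ℕ) (M : SymbolArray r s k) : Prop where
  isLambdaMatrix : M.IsLambdaMatrix lam
  occ_le : ∀ l, M.occ l ≤ ρ l
  rowOcc_le : ∀ i l, M.rowOcc i l ≤ lam
  colOcc_le : ∀ j l, M.colOcc j l ≤ lam

/-- An `n × n` `(ρ, lam)`-Latin square. -/
structure IsLatinSquare {n : ℕ} (ρ : Fin k → ℕ) (lam : ℕ) (M : SymbolArray n n k) : Prop where
  isLambdaMatrix : M.IsLambdaMatrix lam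
  occ_eq : ∀ l, M.occ l = ρ l
  rowOcc_le : ∀ i l, M.rowOcc i l ≤ lam
  colOcc_le : ∀ j l, M.colOcc j l ≤ lam

/-- An array is simple if no symbol is repeated in any cell. -/
def IsSimple (M : SymbolArray r s k) : Prop :=
  ∀ i j l, M.cellOcc i j l ≤ 1

/-- `N` extends `M`: the upper left `r × s` corner of `N` is `M`. -/
def Extends {r' s' : ℕ} (hr : r ≤ r') (hs : s ≤ s')
    (N : SymbolArray r' s' k) (M : SymbolArray r s k) : Prop :=
  ∀ i j, N (Fin.castLE hr i) (Fin.castLE hs j) = M i j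

end SymbolArray

/-! Let `m = n - r`. What matters about the `m` new rows is `e j l`, the number of times symbol `l`
occurs in them in column `j`. Such an `e` is at most `m` and at most `lam` minus the occurrences
already in the column, has sum `lam * m` in each column of the array, and gives each symbol its
missing total, which is at most `lam * m`.

Conversely, any such `e` comes from a completion (`exists_completion_iff`). Seen as a bipartite
multigraph between columns and symbols, it splits into `m` simple graphs, one per new row
(`exists_layers`). One layer is an integral rounding of `e / m`, with bounds chosen so that the
remainder satisfies the same hypotheses for `m - 1`.

Finding `e` is a transportation problem, solvable under the cut condition (`exists_transport`, by
Hall's theorem). The last inequality of the theorem is this condition maximized over sets of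
columns, and the first is the degree bound needed for splitting. -/

/-! ### Transportation problems -/

open Finset in
/-- Integral transportation problem with prescribed margins and cell capacities: the cut condition
suffices for feasibility. -/
theorem exists_transport {J L : Type*} [Fintype J] [Fintype L] [DecidableEq J] [DecidableEq L]
    (a : J → ℕ) (d : L → ℕ) (c : J → L → ℕ) (hsum : ∑ j, a j = ∑ l, d l)
    (hcut : ∀ (S : Finset J) (T : Finset L),
      ∑ j ∈ S, a j ≤ ∑ j ∈ S, ∑ l ∈ T, c j l + ∑ l ∈ Tᶜ, d l) :
    ∃ y : J → L → ℕ, (∀ j l, y j l ≤ c j l) ∧ (∀ j, ∑ l, y j l = a j) ∧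
      ∀ l, ∑ j, y j l = d l := by
  classical
  have hdc : ∀ l, d l ≤ ∑ j, c j l := by
    intro l
    have h1 := hcut univ {l}
    rw [hsum, ← Finset.sum_add_sum_compl {l} d] at h1
    simpa using h1
  -- Slots are units of capacity. Left tokens are units of supply; right tokens block the excess
  -- capacity of column `l`, leaving at most `d l` slots for supply.
  let Slot := Σ p : J × L, Fin (c p.1 p.2)
  let Tok := (Σ j : J, Fin (a j)) ⊕ (Σ l : L, Fin (∑ j, c j l - d l))
  let t : Tok → Finset Slot := fun s => match s with
    | .inl u => univ.filter fun q => q.1.1 = u.1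
    | .inr u => univ.filter fun q => q.1.2 = u.1
  have hall : ∀ S : Finset Tok, S.card ≤ (S.biUnion t).card := by
    intro S
    let J0 : Finset J := univ.filter fun j => ∃ i, (Sum.inl ⟨j, i⟩ : Tok) ∈ S
    let L0 : Finset L := univ.filter fun l => ∃ i, (Sum.inr ⟨l, i⟩ : Tok) ∈ S
    have h1 : S.card ≤ ∑ j ∈ J0, a j + ∑ l ∈ L0, (∑ j, c j l - d l) := by
      have hsub : S ⊆ (J0.sigma fun _ => univ).disjSum (L0.sigma fun _ => univ) := by
        rintro (⟨j, i⟩ | ⟨l, i⟩) hs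
        · exact Finset.inl_mem_disjSum.mpr
            (mem_sigma.mpr ⟨mem_filter.mpr ⟨mem_univ _, i, hs⟩, mem_univ _⟩)
        · exact Finset.inr_mem_disjSum.mpr
            (mem_sigma.mpr ⟨mem_filter.mpr ⟨mem_univ _, i, hs⟩, mem_univ _⟩)
      refine (card_le_card hsub).trans ?_
      rw [card_disjSum, card_sigma, card_sigma]
      simp
    -- The slots adjacent to `S` fill rows `J0` and columns `L0`, so Hall's inequality reduces to
    -- the cut `(J0, L0ᶜ)`.
    have h2 : (((J0 ×ˢ L0ᶜ) ∪ (univ ×ˢ L0)).sigma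
        fun p : J × L => (univ : Finset (Fin (c p.1 p.2)))) ⊆ S.biUnion t := by
      rintro ⟨⟨j, l⟩, i⟩ hq
      simp only [mem_sigma, mem_union, mem_product, mem_univ, and_true, true_and] at hq
      rw [mem_biUnion]
      rcases hq with ⟨hj, -⟩ | hl
      · obtain ⟨i, hi⟩ := (mem_filter.mp hj).2
        exact ⟨_, hi, by simp [t]⟩
      · obtain ⟨i, hi⟩ := (mem_filter.mp hl).2
        exact ⟨_, hi, by simp [t]⟩
    have h3 := card_le_card h2
    rw [card_sigma, sum_union (by
      rw [Finset.disjoint_left]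
      rintro ⟨j, l⟩ h h'
      simp only [mem_product, mem_compl] at h h'
      exact h.2 h'.2), sum_product, sum_product_right] at h3
    simp only [card_univ, Fintype.card_fin] at h3
    have h4 := hcut J0 L0ᶜ
    rw [compl_compl] at h4
    have h5 : ∑ l ∈ L0, (∑ j, c j l - d l) + ∑ l ∈ L0, d l = ∑ l ∈ L0, ∑ j, c j l := by
      rw [← sum_add_distrib]
      exact sum_congr rfl fun l _ => Nat.sub_add_cancel (hdc l)
    omega
  obtain ⟨f, hf, hft⟩ := (Finset.all_card_le_biUnion_card_iff_exists_injective t).mp hall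
  have hfl : ∀ j i, (f (.inl ⟨j, i⟩)).1.1 = j := fun j i => by
    simpa [t] using hft (.inl ⟨j, i⟩)
  have hfr : ∀ l i, (f (.inr ⟨l, i⟩)).1.2 = l := fun l i => by
    simpa [t] using hft (.inr ⟨l, i⟩)
  let y : J → L → ℕ := fun j l => (univ.filter fun i => (f (.inl ⟨j, i⟩)).1.2 = l).card
  have hrow : ∀ j, ∑ l, y j l = a j := by
    intro j
    have := card_eq_sum_card_fiberwise (s := (univ : Finset (Fin (a j)))) (t := univ)
      (f := fun i => (f (.inl ⟨j, i⟩)).1.2) (fun _ _ => by simp)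
    simpa [y] using this.symm
  have hcol : ∀ l, ∑ j, y j l ≤ d l := by
    intro l
    have h1 : (((univ : Finset J).sigma fun j => univ.filter fun i =>
          (f (.inl ⟨j, i⟩)).1.2 = l).disjSum
        (({l} : Finset L).sigma fun l => (univ : Finset (Fin (∑ j, c j l - d l))))).card ≤
        (((univ : Finset J) ×ˢ ({l} : Finset L)).sigma
          fun p : J × L => (univ : Finset (Fin (c p.1 p.2)))).card := by
      refine card_le_card_of_injOn f ?_ hf.injOn
      rintro (⟨j, i⟩ | ⟨l', i⟩) hs
      · have hs' : (f (.inl ⟨j, i⟩)).1.2 = l := by simpa using hs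
        exact mem_sigma.mpr ⟨mem_product.mpr ⟨mem_univ _, mem_singleton.mpr hs'⟩, mem_univ _⟩
      · simp only [mem_coe, Finset.inr_mem_disjSum, mem_sigma, mem_singleton, mem_univ,
          and_true] at hs
        subst hs
        exact mem_sigma.mpr
          ⟨mem_product.mpr ⟨mem_univ _, mem_singleton.mpr (hfr l' i)⟩, mem_univ _⟩
    rw [card_disjSum, card_sigma, card_sigma, card_sigma, sum_product] at h1
    simp only [sum_singleton, card_univ, Fintype.card_fin] at h1
    have := hdc l
    change ∑ j, y j l + _ ≤ _ at h1
    omega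
  refine ⟨y, ?_, hrow, ?_⟩
  · intro j l
    have h1 : (univ.filter fun i => (f (.inl ⟨j, i⟩)).1.2 = l).card ≤
        (({(j, l)} : Finset (J × L)).sigma
          fun p : J × L => (univ : Finset (Fin (c p.1 p.2)))).card := by
      refine card_le_card_of_injOn (fun i => f (.inl ⟨j, i⟩)) ?_ ?_
      · intro i hi
        have hi' : (f (.inl ⟨j, i⟩)).1.2 = l := by simpa using hi
        simpa using Prod.ext (hfl j i) hi'
      · intro i _ i' _ h
        simpa using Sum.inl.inj (hf h)
    simpa [card_sigma] using h1
  -- Equal totals turn the column bounds into equalities.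
  · have htot : ∑ l, ∑ j, y j l = ∑ l, d l := by
      rw [sum_comm, ← hsum]
      exact sum_congr rfl fun j _ => hrow j
    exact fun l => (sum_eq_sum_iff_of_le fun l _ => hcol l).mp htot l (mem_univ l)

open Finset in
/-- A transportation problem with integral margins and integral cell bounds that has a rational
solution has an integral solution. -/
theorem exists_integral_transport {J L : Type*} [Fintype J] [Fintype L] [DecidableEq J]
    [DecidableEq L] (a : J → ℤ) (d : L → ℤ) (lo hi : J → L → ℤ) (x : J → L → ℚ)
    (hlo : ∀ j l, (lo j l : ℚ) ≤ x j l) (hhi : ∀ j l, x j l ≤ hi j l)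
    (ha : ∀ j, ∑ l, x j l = a j) (hd : ∀ l, ∑ j, x j l = d l) :
    ∃ y : J → L → ℤ, (∀ j l, lo j l ≤ y j l) ∧ (∀ j l, y j l ≤ hi j l) ∧
      (∀ j, ∑ l, y j l = a j) ∧ ∀ l, ∑ j, y j l = d l := by
  have hlohi : ∀ j l, lo j l ≤ hi j l := fun j l => by
    exact_mod_cast (hlo j l).trans (hhi j l)
  have ha0 : ∀ j, 0 ≤ a j - ∑ l, lo j l := fun j => by
    have : ((∑ l, lo j l : ℤ) : ℚ) ≤ a j := by
      rw [← ha j]; push_cast; exact sum_le_sum fun l _ => hlo j l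
    have : ∑ l, lo j l ≤ a j := by exact_mod_cast this
    omega
  have hd0 : ∀ l, 0 ≤ d l - ∑ j, lo j l := fun l => by
    have : ((∑ j, lo j l : ℤ) : ℚ) ≤ d l := by
      rw [← hd l]; push_cast; exact sum_le_sum fun j _ => hlo j l
    have : ∑ j, lo j l ≤ d l := by exact_mod_cast this
    omega
  obtain ⟨y, hy, hya, hyd⟩ := exists_transport (fun j => (a j - ∑ l, lo j l).toNat)
    (fun l => (d l - ∑ j, lo j l).toNat) (fun j l => (hi j l - lo j l).toNat) (by
      zify
      simp only [Int.toNat_of_nonneg (ha0 _), Int.toNat_of_nonneg (hd0 _)]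
      rw [sum_sub_distrib, sum_sub_distrib, sum_comm (f := fun j l => lo j l)]
      have : ((∑ j, a j : ℤ) : ℚ) = (∑ l, d l : ℤ) := by
        push_cast
        simp only [← ha, ← hd]
        exact sum_comm
      have : ∑ j, a j = ∑ l, d l := by exact_mod_cast this
      rw [this]) (by
      intro S T
      zify
      simp only [Int.toNat_of_nonneg (ha0 _), Int.toNat_of_nonneg (hd0 _),
        Int.toNat_of_nonneg (sub_nonneg.mpr (hlohi _ _))]
      rw [← Int.cast_le (R := ℚ)]
      push_cast
      simp only [← ha, ← hd, ← sum_sub_distrib]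
      -- After subtracting `lo`, the rational solution certifies every cut: capacities bound it on
      -- `T`, column margins on `Tᶜ`.
      have h1 : ∀ j ∈ S, ∑ l, (x j l - lo j l) ≤
          ∑ l ∈ T, ((hi j l : ℚ) - lo j l) + ∑ l ∈ Tᶜ, (x j l - lo j l) := by
        intro j _
        rw [← sum_add_sum_compl T]
        gcongr with l _
        exact hhi j l
      refine (sum_le_sum h1).trans ?_
      rw [sum_add_distrib, sum_comm (s := S) (t := Tᶜ)]
      gcongr with l _
      · exact fun j _ _ => sub_nonneg.mpr (hlo j l)
      · exact subset_univ S)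
  refine ⟨fun j l => lo j l + y j l, fun j l => by simp, fun j l => ?_, fun j => ?_, fun l => ?_⟩
  · have := hy j l
    have := hlohi j l
    simp only
    omega
  · have := congrArg (Nat.cast : ℕ → ℤ) (hya j)
    push_cast [Int.toNat_of_nonneg (ha0 j)] at this
    rw [sum_add_distrib]
    omega
  · have := congrArg (Nat.cast : ℕ → ℤ) (hyd l)
    push_cast [Int.toNat_of_nonneg (hd0 l)] at this
    rw [sum_add_distrib]
    omega

/-! ### Splitting a multigraph into simple layers -/

open Finset in
/-- A bipartite multigraph with edge multiplicities at most `m + 1`, left degrees `q * (m + 1)` and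
right degrees at most `q * (m + 1)` has a simple subgraph with left degrees `q`, right degrees at
most `q`, whose removal leaves multiplicities at most `m` and right degrees at most `q * m`. -/
theorem exists_layer {J L : Type*} [Fintype J] [Fintype L] [DecidableEq J] [DecidableEq L]
    (q m : ℕ) (e : J → L → ℕ) (he : ∀ j l, e j l ≤ m + 1)
    (hrow : ∀ j, ∑ l, e j l = q * (m + 1)) (hcol : ∀ l, ∑ j, e j l ≤ q * (m + 1)) :
    ∃ y : J → L → ℕ, (∀ j l, y j l ≤ 1) ∧ (∀ j l, y j l ≤ e j l) ∧
      (∀ j l, e j l ≤ m + y j l) ∧ (∀ j, ∑ l, y j l = q) ∧ (∀ l, ∑ j, y j l ≤ q) ∧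
      ∀ l, ∑ j, e j l ≤ q * m + ∑ j, y j l := by
  have hm : (0 : ℚ) < m + 1 := by positivity
  have hrowQ : ∀ j, ∑ l, (e j l : ℚ) = q * (m + 1) := fun j => by exact_mod_cast hrow j
  have hcolQ : ∀ l, ∑ j, (e j l : ℚ) ≤ q * (m + 1) := fun l => by exact_mod_cast hcol l
  -- The solution to round is `e / (m + 1)`. The row `none` absorbs the slack `q - ∑ j, y j l`; its
  -- lower bound `0` caps the layer's right degrees at `q`, its upper bound caps those of the
  -- remainder at `q * m`.
  obtain ⟨y, hylo, hyhi, hya, hyd⟩ := exists_integral_transport (J := Option J) (L := L)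
    (fun j => j.elim ((q : ℤ) * Fintype.card L - q * Fintype.card J) fun _ => q)
    (fun _ => q)
    (fun j l => j.elim 0 fun j => max 0 ((e j l : ℤ) - m))
    (fun j l => j.elim (q * (m + 1) - ∑ j, (e j l : ℤ)) fun j => min 1 (e j l : ℤ))
    (fun j l => j.elim (q - (∑ j, (e j l : ℚ)) / (m + 1)) fun j => (e j l : ℚ) / (m + 1))
    (by
      rintro (_ | j) l
      · simp only [Option.elim_none, Int.cast_zero, sub_nonneg]
        rw [div_le_iff₀ hm]
        exact hcolQ l
      · simp only [Option.elim_some, Int.cast_max, Int.cast_zero, Int.cast_sub, Int.cast_natCast,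
          max_le_iff]
        refine ⟨by positivity, ?_⟩
        rw [le_div_iff₀ hm]
        have : (e j l : ℚ) ≤ m + 1 := by exact_mod_cast he j l
        have hm0 : (0 : ℚ) ≤ m := by positivity
        nlinarith)
    (by
      rintro (_ | j) l
      · simp only [Option.elim_none]
        push_cast
        have h0 : 0 ≤ (q : ℚ) * (m + 1) - ∑ j, (e j l : ℚ) := sub_nonneg.mpr (hcolQ l)
        have h1 : (q : ℚ) - (∑ j, (e j l : ℚ)) / (m + 1) =
          (q * (m + 1) - ∑ j, (e j l : ℚ)) / (m + 1) := by field_simp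
        rw [h1]
        exact div_le_self h0 (by simp)
      · simp only [Option.elim_some, Int.cast_min, Int.cast_one, Int.cast_natCast, le_min_iff]
        refine ⟨?_, div_le_self (by positivity) (by simp)⟩
        rw [div_le_one hm]
        exact_mod_cast he j l)
    (by
      rintro (_ | j)
      · simp only [Option.elim_none]
        rw [sum_sub_distrib, ← sum_div, sum_comm]
        simp only [hrowQ]
        push_cast
        simp only [sum_const, card_univ, nsmul_eq_mul]
        field_simp
      · simp only [Option.elim_some]
        rw [← sum_div, hrowQ]
        push_cast
        field_simp)
    (by
      intro l
      rw [Fintype.sum_option]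
      simp only [Option.elim_none, Option.elim_some]
      rw [← sum_div]
      push_cast
      ring)
  have hy0 : ∀ j l, 0 ≤ y (some j) l := fun j l =>
    (le_max_left _ _).trans (hylo (some j) l)
  have hyN : ∀ j l, ((y (some j) l).toNat : ℤ) = y (some j) l := fun j l =>
    Int.toNat_of_nonneg (hy0 j l)
  refine ⟨fun j l => (y (some j) l).toNat, fun j l => ?_, fun j l => ?_, fun j l => ?_,
    fun j => ?_, fun l => ?_, fun l => ?_⟩ <;> beta_reduce
  · have := hyhi (some j) l
    simp only [Option.elim_some] at this
    omega
  · have := hyhi (some j) l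
    simp only [Option.elim_some] at this
    omega
  · have := hylo (some j) l
    simp only [Option.elim_some] at this
    omega
  · have := hya (some j)
    zify
    simpa only [hyN, Option.elim_some] using this
  · have h1 := hyd l
    have h2 := hylo none l
    rw [Fintype.sum_option] at h1
    simp only [Option.elim_none] at h2
    zify
    simp only [hyN]
    omega
  · have h1 := hyd l
    have h2 := hyhi none l
    rw [Fintype.sum_option] at h1
    simp only [Option.elim_none] at h2
    zify
    simp only [hyN]
    linarith

open Finset in
/-- A bipartite multigraph with edge multiplicities at most `m`, left degrees `q * m` and
right degrees at most `q * m` decomposes into `m` simple graphs with left degrees `q` and right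
degrees at most `q`. -/
theorem exists_layers {J L : Type*} [Fintype J] [Fintype L] [DecidableEq J] [DecidableEq L]
    (q m : ℕ) (e : J → L → ℕ) (he : ∀ j l, e j l ≤ m)
    (hrow : ∀ j, ∑ l, e j l = q * m) (hcol : ∀ l, ∑ j, e j l ≤ q * m) :
    ∃ f : Fin m → J → L → ℕ, (∀ i j l, f i j l ≤ 1) ∧ (∀ j l, ∑ i, f i j l = e j l) ∧
      (∀ i j, ∑ l, f i j l = q) ∧ ∀ i l, ∑ j, f i j l ≤ q := by
  induction m generalizing e with
  | zero =>
    refine ⟨fun _ _ _ => 0, by simp, fun j l => ?_, fun i => i.elim0, fun i => i.elim0⟩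
    have := he j l
    simp
    omega
  | succ m ih =>
    obtain ⟨y, hy1, hye, hey, hyrow, hycol, hecol⟩ := exists_layer q m e he hrow hcol
    have hsum : ∀ j l, e j l - y j l + y j l = e j l := fun j l => Nat.sub_add_cancel (hye j l)
    obtain ⟨f, hf1, hfe, hfrow, hfcol⟩ := ih (fun j l => e j l - y j l)
      (fun j l => by have := hey j l; omega)
      (fun j => by
        have h := hrow j
        rw [← sum_congr rfl fun l _ => hsum j l, sum_add_distrib, hyrow, mul_add] at h
        omega)
      (fun l => by
        have h := hecol l
        rw [← sum_congr rfl fun j _ => hsum j l, sum_add_distrib] at h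
        omega)
    refine ⟨Fin.cons y f, fun i => ?_, fun j l => ?_, fun i => ?_, fun i => ?_⟩
    · refine Fin.cases ?_ (fun i => ?_) i
      · simpa using hy1
      · simpa using hf1 i
    · rw [Fin.sum_univ_succ]
      simp only [Fin.cons_zero, Fin.cons_succ, hfe]
      have := hye j l
      omega
    · refine Fin.cases ?_ (fun i => ?_) i
      · simpa using hyrow
      · simpa using hfrow i
    · refine Fin.cases ?_ (fun i => ?_) i
      · simpa using hycol
      · simpa using hfcol i

/-! ### Completions and their profiles -/

namespace SymbolArray

theorem sum_cellOcc {r s k lam : ℕ} {M : SymbolArray r s k} (hM : M.IsLambdaMatrix lam)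
    (i : Fin r) (j : Fin s) : ∑ l, M.cellOcc i j l = lam := by
  rw [← hM i j]
  exact Multiset.sum_count_eq_card fun _ _ => Finset.mem_univ _

theorem sum_occ {r s k lam : ℕ} {M : SymbolArray r s k} (hM : M.IsLambdaMatrix lam) :
    ∑ l, M.occ l = r * (s * lam) := by
  simp only [occ]
  rw [Finset.sum_comm]
  simp only [Finset.sum_comm (γ := Fin k), sum_cellOcc hM]
  simp

/-- A multiplicity function for the remaining rows: the numbers of occurrences of symbols in the
columns of a simple completion by `m` rows. -/
structure IsCompletionProfile {r n k : ℕ} (ρ : Fin k → ℕ) (lam m : ℕ) (M : SymbolArray r n k)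
    (e : Fin n → Fin k → ℕ) : Prop where
  le : ∀ j l, e j l ≤ m
  colOcc_add_le : ∀ j l, M.colOcc j l + e j l ≤ lam
  sum_row : ∀ j, ∑ l, e j l = lam * m
  occ_add_sum : ∀ l, M.occ l + ∑ j, e j l = ρ l
  sum_col_le : ∀ l, ∑ j, e j l ≤ lam * m

/-- The array obtained by putting `A` below `M`. -/
def stack {r m s k : ℕ} (M : SymbolArray r s k) (A : SymbolArray m s k) :
    SymbolArray (r + m) s k :=
  Fin.addCases M A

theorem cellOcc_stack_castAdd {r m s k : ℕ} (M : SymbolArray r s k) (A : SymbolArray m s k)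
    (i : Fin r) : (M.stack A).cellOcc (Fin.castAdd m i) = M.cellOcc i := by
  funext j l
  simp [cellOcc, stack]

theorem cellOcc_stack_natAdd {r m s k : ℕ} (M : SymbolArray r s k) (A : SymbolArray m s k)
    (i : Fin m) : (M.stack A).cellOcc (Fin.natAdd r i) = A.cellOcc i := by
  funext j l
  simp [cellOcc, stack]

/-- A layer is a new row: left degree `lam` is the cell size, the right degree bound is the row
condition, and multiplicity at most one is simplicity. -/
theorem exists_completion_iff {r m k lam : ℕ} (hrn : r ≤ r + m) (ρ : Fin k → ℕ)
    (M : SymbolArray r (r + m) k) (hM : M.IsLatinRectangle ρ lam) (hMs : M.IsSimple) :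
    (∃ N : SymbolArray (r + m) (r + m) k,
        N.IsLatinSquare ρ lam ∧ N.IsSimple ∧ N.Extends hrn le_rfl M) ↔
      ∃ e, M.IsCompletionProfile ρ lam m e := by
  constructor
  · rintro ⟨N, hN, hNs, hNM⟩
    have hcell : ∀ i, N.cellOcc (Fin.castAdd m i) = M.cellOcc i := fun i => by
      funext j l
      exact congrArg (Multiset.count l) (hNM i j)
    refine ⟨fun j l => ∑ i : Fin m, N.cellOcc (Fin.natAdd r i) j l, ?_, ?_, ?_, ?_, ?_⟩
    · intro j l
      simpa using Finset.sum_le_sum fun (i : Fin m) (_ : i ∈ Finset.univ) =>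
        hNs (Fin.natAdd r i) j l
    · intro j l
      have := hN.colOcc_le j l
      rw [colOcc, Fin.sum_univ_add] at this
      simpa only [hcell, colOcc] using this
    · intro j
      rw [Finset.sum_comm]
      simp [sum_cellOcc hN.isLambdaMatrix, mul_comm]
    · intro l
      have h : N.occ l = M.occ l + ∑ i : Fin m, ∑ j, N.cellOcc (Fin.natAdd r i) j l := by
        rw [occ, Fin.sum_univ_add]
        simp only [hcell, occ]
      rw [← hN.occ_eq l, h, Finset.sum_comm]
    · intro l
      rw [Finset.sum_comm]
      simpa [mul_comm, rowOcc] using Finset.sum_le_sum fun (i : Fin m) (_ : i ∈ Finset.univ) =>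
        hN.rowOcc_le (Fin.natAdd r i) l
  · rintro ⟨e, he⟩
    obtain ⟨f, hf1, hfe, hfrow, hfcol⟩ := exists_layers lam m e he.le he.sum_row he.sum_col_le
    let A : SymbolArray m (r + m) k := fun i j => (Finset.univ.filter fun l => f i j l = 1).val
    have hA : A.cellOcc = f := by
      funext i j l
      have := hf1 i j l
      simp only [cellOcc, A]
      rw [Multiset.count_eq_of_nodup (Finset.nodup _)]
      simp only [Finset.mem_val, Finset.mem_filter, Finset.mem_univ, true_and]
      split_ifs <;> omega
    have hcard : (M.stack A).IsLambdaMatrix lam := by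
      intro i j
      refine Fin.addCases (fun i => ?_) (fun i => ?_) i
      · simpa [stack] using hM.isLambdaMatrix i j
      · have h : Multiset.card (A i j) = ∑ l, A.cellOcc i j l :=
          (Multiset.sum_count_eq_card fun _ _ => Finset.mem_univ _).symm
        simpa [stack, hA, hfrow] using h
    refine ⟨M.stack A, ⟨hcard, fun l => ?_, fun i l => ?_, fun j l => ?_⟩, fun i j l => ?_,
      fun i j => ?_⟩
    · rw [← he.occ_add_sum l, occ, Fin.sum_univ_add]
      simp only [cellOcc_stack_castAdd, cellOcc_stack_natAdd, hA]
      rw [Finset.sum_comm (s := (Finset.univ : Finset (Fin m)))]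
      simp only [hfe, occ]
    · refine Fin.addCases (fun i => ?_) (fun i => ?_) i
      · simpa only [rowOcc, cellOcc_stack_castAdd] using hM.rowOcc_le i l
      · simpa only [rowOcc, cellOcc_stack_natAdd, hA] using hfcol i l
    · rw [colOcc, Fin.sum_univ_add]
      simp only [cellOcc_stack_castAdd, cellOcc_stack_natAdd, hA, hfe]
      exact he.colOcc_add_le j l
    · refine Fin.addCases (fun i => ?_) (fun i => ?_) i
      · simpa only [cellOcc_stack_castAdd] using hMs i j l
      · simpa only [cellOcc_stack_natAdd, hA] using hf1 i j l
    · exact congrFun (Fin.addCases_left (motive := fun _ => Fin (r + m) → Multiset (Fin k)) i) j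

end SymbolArray

/-! ### The characterization -/

theorem mainTheorem7 (r n k lam : ℕ) (hn : 1 ≤ n) (hrn : r ≤ n) (hnk : n ≤ k)
    (ρ : Fin k → ℕ) (hρ_pos : ∀ l, 1 ≤ ρ l) (hρ_le : ∀ l, ρ l ≤ lam * n)
    (hρ_sum : ∑ l, ρ l = lam * n ^ 2)
    (M : SymbolArray r n k) (hM : M.IsLatinRectangle ρ lam) (hMs : M.IsSimple) :
    (∃ N : SymbolArray n n k,
        N.IsLatinSquare ρ lam ∧ N.IsSimple ∧ N.Extends hrn le_rfl M) ↔
      (lam ≤ k ∧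
        (∀ l, (ρ l : ℤ) - M.occ l ≤ lam * ((n : ℤ) - r)) ∧
        (∀ j, (lam : ℤ) * ((n : ℤ) - r) ≤
          ∑ l, min ((n : ℤ) - r) ((lam : ℤ) - M.colOcc j l)) ∧
        (∀ l, (ρ l : ℤ) - M.occ l ≤
          ∑ j, min ((n : ℤ) - r) ((lam : ℤ) - M.colOcc j l)) ∧
        (∀ K : Finset (Fin k),
          ∑ j, max 0 ((lam : ℤ) * ((n : ℤ) - r) -
              ∑ l ∈ K, min ((n : ℤ) - r) ((lam : ℤ) - M.colOcc j l)) ≤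
            ∑ l ∈ Kᶜ, ((ρ l : ℤ) - M.occ l))) := by
  obtain ⟨m, rfl⟩ := Nat.exists_eq_add_of_le hrn
  have hm : ((r + m : ℕ) : ℤ) - r = m := by push_cast; ring
  simp only [hm]
  constructor
  · intro hN
    have hk : lam ≤ k := by
      obtain ⟨N, hN, hNs, -⟩ := hN
      rw [← SymbolArray.sum_cellOcc hN.isLambdaMatrix ⟨0, hn⟩ ⟨0, hn⟩]
      simpa using Finset.sum_le_sum fun l (_ : l ∈ Finset.univ) => hNs ⟨0, hn⟩ ⟨0, hn⟩ l
    obtain ⟨e, he⟩ := (M.exists_completion_iff hrn ρ hM hMs).mp hN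
    have hd : ∀ l, (ρ l : ℤ) - M.occ l = ∑ j, (e j l : ℤ) := fun l => by
      have := congrArg (Nat.cast : ℕ → ℤ) (he.occ_add_sum l)
      push_cast at this
      linarith
    have hc : ∀ j l, (e j l : ℤ) ≤ min (m : ℤ) ((lam : ℤ) - M.colOcc j l) := fun j l => by
      have h1 := he.le j l
      have h2 := he.colOcc_add_le j l
      omega
    have hrow : ∀ j, (lam : ℤ) * m = ∑ l, (e j l : ℤ) := fun j => by
      exact_mod_cast (he.sum_row j).symm
    refine ⟨hk, fun l => ?_, fun j => ?_, fun l => ?_, fun K => ?_⟩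
    · rw [hd]
      exact_mod_cast he.sum_col_le l
    · rw [hrow j]
      exact Finset.sum_le_sum fun l _ => hc j l
    · rw [hd]
      exact Finset.sum_le_sum fun j _ => hc j l
    · simp only [hd]
      rw [Finset.sum_comm]
      refine Finset.sum_le_sum fun j _ => max_le (Finset.sum_nonneg fun l _ => by positivity) ?_
      rw [hrow j, ← Finset.sum_add_sum_compl K]
      have := Finset.sum_le_sum fun l (_ : l ∈ K) => hc j l
      linarith
  · rintro ⟨-, hocc, -, -, hcut⟩
    rw [M.exists_completion_iff hrn ρ hM hMs]
    have hc : ∀ j l, ((min m (lam - M.colOcc j l) : ℕ) : ℤ) =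
        min (m : ℤ) ((lam : ℤ) - M.colOcc j l) := fun j l => by
      rw [Nat.cast_min, Nat.cast_sub (hM.colOcc_le j l)]
    have hd : ∀ l, ((ρ l - M.occ l : ℕ) : ℤ) = (ρ l : ℤ) - M.occ l := fun l =>
      Nat.cast_sub (hM.occ_le l)
    obtain ⟨e, hec, hrow, hcol⟩ := exists_transport (fun _ : Fin (r + m) => lam * m)
      (fun l => ρ l - M.occ l) (fun j l => min m (lam - M.colOcc j l)) (by
        zify
        simp only [hd]
        rw [Finset.sum_sub_distrib]
        have h1 := congrArg (Nat.cast : ℕ → ℤ) hρ_sum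
        have h2 := congrArg (Nat.cast : ℕ → ℤ) (SymbolArray.sum_occ hM.isLambdaMatrix)
        push_cast at h1 h2
        rw [h1, h2]
        simp only [Finset.sum_const, Finset.card_univ, Fintype.card_fin, nsmul_eq_mul]
        push_cast
        ring) (by
        intro S T
        have h := hcut T
        -- The sum of positive parts dominates the sum over any `S`, so one inequality per `T`
        -- covers all cuts.
        have h1 : ∑ j ∈ S, ((lam : ℤ) * m - ∑ l ∈ T, min (m : ℤ) ((lam : ℤ) - M.colOcc j l)) ≤
            ∑ j, max 0 ((lam : ℤ) * m - ∑ l ∈ T, min (m : ℤ) ((lam : ℤ) - M.colOcc j l)) :=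
          (Finset.sum_le_sum fun j _ => le_max_right _ _).trans
            (Finset.sum_le_sum_of_subset_of_nonneg (Finset.subset_univ S)
              fun j _ _ => le_max_left _ _)
        rw [Finset.sum_sub_distrib] at h1
        rw [← Nat.cast_le (α := ℤ)]
        simp only [Nat.cast_add, Nat.cast_sum, hc, hd, Nat.cast_mul]
        linarith)
    refine ⟨e, fun j l => (hec j l).trans (min_le_left _ _), fun j l => ?_, hrow, fun l => ?_,
      fun l => ?_⟩
    · have h1 := hec j l
      have h2 := hM.colOcc_le j l
      omega
    · rw [hcol]
      exact Nat.add_sub_cancel' (hM.occ_le l)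
    · rw [hcol]
      have := hocc l
      rw [← hd] at this
      exact_mod_cast this
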